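/- For an integer $n\ge 2$ let $\mathcal M_n:[0,\infty)\to\mathbb R$ be the solution of $\mathcal M_n'(x)=1-\mathcal M_n(x)^{2/n}$ for $x\ge 0$, $\mathcal M_n(0)=0$ (one-sided derivative at $0$); such a solution exists and is unique. For $\alpha\in(0,1]$ put $$\gamma_\alpha=\frac1\alpha\exp\Bigl(-\int_0^1\frac{1-x^{(1-\alpha)/\alpha}}{1-x}\,dx\Bigr),$$ and define $\sigma_k=\sigma_k(\alpha)$ by $\sigma_1=1$ and $$\sigma_k=\frac1{k(k-1)}\sum_{\nu=1}^{k-1}\sigma_\nu\,\sigma_{k-\nu}\,[(1+\alpha)\nu-\alpha k]\,\nu\qquad(k\ge 2).$$ With $\alpha=2/n$ let $a_k=\sigma_k\gamma_{2/n}^k$ for $k\ge1$. Then for all $x\ge 0$ the series below converges and $$1-\mathcal M_n(x)=\sum_{k=1}^\infty a_k e^{-2kx/n}.$$ If $n\ge 3$, then $a_k>0$ for all $k\ge1$; if $n=2$, then $a_1=1$ and $a_k=0$ for all $k\ge 2$. Consequently there is exactly one positive Borel measure $\mu$ on $[0,\infty)$ with $1-\mathcal M_n(x)=\int_{[0,\infty)}e^{-xt}\,d\mu(t)$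 (a convergent integral) for all $x\ge 0$; it is a probability measure, and it is the atomic measure $\mu=\sum_{k\ge1}a_k\delta_{2k/n}$. In particular $\mu$ is concentrated on $\{2k/n: k=1,2,3,\dots\}$, and $\mu(\{2k/n\})=a_k$ for every $k\ge1$. -/

import Mathlib

open Set MeasureTheory

/-- `F` solves `F' = 1 - F ^ α` on `[0, ∞)` with `F 0 = 0` (one-sided derivative at the
end point). Values of `F` off `[0, ∞)` are irrelevant. Nonnegativity of `F` is not assumed: it
is forced by the equation, since the derivative is `1` at each zero of `F` (for `α ≠ 0`). -/
def IsPowerODESolution (α : ℝ) (F : ℝ → ℝ) : Prop :=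
  F 0 = 0 ∧ ∀ x : ℝ, 0 ≤ x → HasDerivWithinAt F (1 - F x ^ α) (Ici 0) x

/-- `M` is the profile function of index `n`, i.e. solves `M' = 1 - M ^ (2 / n)`, `M 0 = 0`. -/
def IsProfile (n : ℕ) (M : ℝ → ℝ) : Prop :=
  IsPowerODESolution (2 / (n : ℝ)) M

/-- The constant `γ_α = (1 / α) exp (-∫₀¹ (1 - x ^ ((1 - α) / α)) / (1 - x) dx)`. -/
noncomputable def gammaConst (α : ℝ) : ℝ :=
  1 / α * Real.exp (-∫ x in (0 : ℝ)..1, (1 - x ^ ((1 - α) / α)) / (1 - x))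

/-- The coefficients `σ_k`, `k ≥ 1` (with the unused value `0` at `k = 0`); the recurrence is
displayed in `sigmaCoeff_one` and `sigmaCoeff_of_two_le`. -/
noncomputable def sigmaCoeff (α : ℝ) (k : ℕ) : ℝ :=
  if k = 0 then 0
  else if k = 1 then 1
  else 1 / ((k : ℝ) * ((k : ℝ) - 1)) *
    ∑ ν ∈ (Finset.Ico 1 k).attach,
      sigmaCoeff α ν.1 * sigmaCoeff α (k - ν.1) *
        ((1 + α) * (ν.1 : ℝ) - α * (k : ℝ)) * (ν.1 : ℝ)
termination_by k
decreasing_by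
  · have := Finset.mem_Ico.mp ν.2
    omega
  · have := Finset.mem_Ico.mp ν.2
    omega

theorem sigmaCoeff_one (α : ℝ) : sigmaCoeff α 1 = 1 := by
  rw [sigmaCoeff]
  simp

theorem sigmaCoeff_of_two_le (α : ℝ) (k : ℕ) (hk : 2 ≤ k) :
    sigmaCoeff α k = 1 / ((k : ℝ) * ((k : ℝ) - 1)) *
      ∑ ν ∈ Finset.Ico 1 k, sigmaCoeff α ν * sigmaCoeff α (k - ν) *
        ((1 + α) * (ν : ℝ) - α * (k : ℝ)) * (ν : ℝ) := by
  rw [sigmaCoeff, if_neg (by omega), if_neg (by omega)]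
  congr 1
  exact Finset.sum_attach (Finset.Ico 1 k) (fun ν => sigmaCoeff α ν * sigmaCoeff α (k - ν) *
        ((1 + α) * (ν : ℝ) - α * (k : ℝ)) * (ν : ℝ))

/-- `a_k = σ_k γ_α ^ k` with `α = 2 / n`. -/
noncomputable def expCoeff (n k : ℕ) : ℝ :=
  sigmaCoeff (2 / (n : ℝ)) k * gammaConst (2 / (n : ℝ)) ^ k

/-- `μ` is a positive measure on `[0, ∞)` whose Laplace transform is `f` on `[0, ∞)`:
`f x = ∫ e^{-x t} dμ(t)` for every `x ≥ 0`. (At `x = 0` integrability says that `μ` is finite.) -/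
def IsLaplaceMeasure (μ : Measure ℝ) (f : ℝ → ℝ) : Prop :=
  μ (Iio 0) = 0 ∧ ∀ x : ℝ, 0 ≤ x →
    Integrable (fun t : ℝ => Real.exp (-(x * t))) μ ∧
      f x = ∫ t, Real.exp (-(x * t)) ∂μ

/-- The atomic measure `∑_{k ≥ 1} a_k δ_{2k/n}`. -/
noncomputable def atomicMeasure (n : ℕ) : Measure ℝ :=
  Measure.sum fun j : ℕ =>
    ENNReal.ofReal (expCoeff n (j + 1)) • Measure.dirac (2 * ((j : ℝ) + 1) / (n : ℝ))

/-! With α = 2/n, put S(y) = ∑ σ_k e^{ky}. The recurrence says that S S'' - α S'² - S'' + S' = 0,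
which makes (1 - α S')(1 - S)^(-α) constant where S < 1. Its limit at -∞ is 1, so α S' = 1 - (1 -
S)^α. Hence x ↦ 1 - S(log γ_α - α x) satisfies the profile equation, and its initial condition
amounts to S(log γ_α) = 1.

That value comes from separating variables: `logPotential` at w = (1 - S)^α, minus y, is constant,
and S ~ e^y at -∞ identifies the constant as -log γ_α. As `logPotential` vanishes at 0 and strictly
decreases, S = 1 at y = log γ_α (`expSeries_sigmaCoeff_log_gammaConst`).

Convergence is obtained from the same two integrations. Symmetrizing the recurrence shows σ_k ≥ 0,
so truncating S leaves a nonnegative defect in the second-order equation. Equalities become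
inequalities in the favourable direction and keep every truncation below 1 for y < log γ_α
(`expSeries_lt_one_of_odeDefect_nonneg`). Bounded partial sums of nonnegative terms then converge,
endpoint included.

The ODE has only one solution because u ↦ 1 - u^α is decreasing on u ≥ 0. The measure is unique
because polynomials in e^{-t} form a point-separating algebra on [0, ∞), and their integrals are
fixed by the Laplace transform at the natural numbers. -/

open Filter Topology
open scoped NNReal

/-! ### The recurrence and the signs of its solution. -/

/-- The coefficients of `S · θ²S - α (θS)² - θ²S + θS`, where `S = ∑ t_k s^k` and `θ = s d/ds`. -/
noncomputable def odeDefect (α : ℝ) (t : ℕ → ℝ) (k : ℕ) : ℝ :=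
  ∑ p ∈ Finset.HasAntidiagonal.antidiagonal k, t p.1 * t p.2 * ((p.2 : ℝ) ^ 2 - α * (p.1 * p.2))
    - ((k : ℝ) ^ 2 - k) * t k

theorem sigmaCoeff_zero (α : ℝ) : sigmaCoeff α 0 = 0 := by
  rw [sigmaCoeff]; simp

theorem sum_sigmaCoeff_eq_sum_antidiagonal (α : ℝ) (k : ℕ) (hk : 1 ≤ k) :
    ∑ ν ∈ Finset.Ico 1 k, sigmaCoeff α ν * sigmaCoeff α (k - ν) *
        ((1 + α) * (ν : ℝ) - α * (k : ℝ)) * (ν : ℝ) =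
      ∑ p ∈ Finset.HasAntidiagonal.antidiagonal k,
        sigmaCoeff α p.1 * sigmaCoeff α p.2 * ((p.2 : ℝ) ^ 2 - α * (p.1 * p.2)) := by
  rw [← Finset.Nat.sum_antidiagonal_swap, Finset.Nat.sum_antidiagonal_eq_sum_range_succ_mk,
    Finset.sum_range_succ, Finset.range_eq_Ico, ← Finset.sum_Ico_consecutive _ zero_le_one hk]
  simp only [Prod.fst_swap, Prod.snd_swap, tsub_self, sigmaCoeff_zero, Nat.Ico_zero_eq_range,
    Finset.range_one, Finset.sum_singleton, zero_mul, mul_zero, zero_add, add_zero]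
  refine Finset.sum_congr rfl fun ν hν => ?_
  have h : ν ≤ k := (Finset.mem_Ico.1 hν).2.le
  push_cast [Nat.cast_sub h]
  ring

theorem odeDefect_sigmaCoeff (α : ℝ) (k : ℕ) : odeDefect α (sigmaCoeff α) k = 0 := by
  unfold odeDefect
  rcases Nat.lt_or_ge k 2 with hk | hk
  · interval_cases k <;> simp [Finset.HasAntidiagonal.antidiagonal, sigmaCoeff_zero]
  · rw [← sum_sigmaCoeff_eq_sum_antidiagonal α k (by omega), sigmaCoeff_of_two_le α k hk]
    have h2 : (2 : ℝ) ≤ k := by exact_mod_cast hk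
    have h1 : (k : ℝ) - 1 ≠ 0 := by linarith
    have h0 : (k : ℝ) ≠ 0 := by linarith
    field_simp
    ring

/-- Averaging the weight q² - αpq with its image under swapping p and q exposes its sign: both
resulting terms are nonnegative when α ≤ 1. -/
theorem sum_antidiagonal_symmetrize (α : ℝ) (t : ℕ → ℝ) (k : ℕ) :
    ∑ p ∈ Finset.HasAntidiagonal.antidiagonal k, t p.1 * t p.2 * ((p.2 : ℝ) ^ 2 - α * (p.1 * p.2)) =
      ∑ p ∈ Finset.HasAntidiagonal.antidiagonal k,
        t p.1 * t p.2 * (((p.1 : ℝ) - p.2) ^ 2 / 2 + (1 - α) * (p.1 * p.2)) := by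
  have h := Finset.Nat.sum_antidiagonal_swap (n := k)
    (f := fun p : ℕ × ℕ => t p.1 * t p.2 * ((p.2 : ℝ) ^ 2 - α * (p.1 * p.2)))
  have h2 : ∀ a b c : ℝ, b = a → c = (a + b) / 2 → a = c := by intro a b c h1 h2; linarith
  refine h2 _ _ _ h ?_
  rw [← Finset.sum_add_distrib, Finset.sum_div]
  refine Finset.sum_congr rfl fun p _ => ?_
  simp only [Prod.fst_swap, Prod.snd_swap]
  ring

theorem sum_antidiagonal_nonneg {α : ℝ} (hα : α ≤ 1) (t : ℕ → ℝ) (k : ℕ)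
    (ht : ∀ p ∈ Finset.HasAntidiagonal.antidiagonal k, 0 ≤ t p.1 * t p.2) :
    0 ≤ ∑ p ∈ Finset.HasAntidiagonal.antidiagonal k, t p.1 * t p.2 * ((p.2 : ℝ) ^ 2 - α * (p.1 * p.2)) := by
  rw [sum_antidiagonal_symmetrize]
  refine Finset.sum_nonneg fun p hp => mul_nonneg (ht p hp) ?_
  have : 0 ≤ 1 - α := by linarith
  positivity

theorem sigmaCoeff_nonneg {α : ℝ} (hα : α ≤ 1) (k : ℕ) : 0 ≤ sigmaCoeff α k := by
  induction k using Nat.strong_induction_on with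
  | _ k ih =>
    rcases Nat.lt_or_ge k 2 with hk | hk
    · interval_cases k <;> simp [sigmaCoeff_zero, sigmaCoeff_one]
    · have h2 : (2 : ℝ) ≤ k := by exact_mod_cast hk
      rw [sigmaCoeff_of_two_le α k hk, sum_sigmaCoeff_eq_sum_antidiagonal α k (by omega)]
      refine mul_nonneg (one_div_nonneg.2 (mul_nonneg (by linarith) (by linarith)))
        (sum_antidiagonal_nonneg hα _ _ fun p hp => ?_)
      have hp' := Finset.HasAntidiagonal.mem_antidiagonal.1 hp
      rcases Nat.eq_zero_or_pos p.1 with h | h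
      · simp [h, sigmaCoeff_zero]
      rcases Nat.eq_zero_or_pos p.2 with h' | h'
      · simp [h', sigmaCoeff_zero]
      exact mul_nonneg (ih _ (by omega)) (ih _ (by omega))

theorem sigmaCoeff_pos {α : ℝ} (hα : α < 1) (k : ℕ) (hk1 : 1 ≤ k) : 0 < sigmaCoeff α k := by
  induction k using Nat.strong_induction_on with
  | _ k ih =>
    rcases Nat.lt_or_ge k 2 with hk | hk
    · obtain rfl : k = 1 := by omega
      simp [sigmaCoeff_one]
    · have h2 : (2 : ℝ) ≤ k := by exact_mod_cast hk
      rw [sigmaCoeff_of_two_le α k hk, sum_sigmaCoeff_eq_sum_antidiagonal α k (by omega),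
        sum_antidiagonal_symmetrize]
      -- The pair (1, k - 1) has both entries positive, so its term (1 - α)pq is strictly positive.
      refine mul_pos (one_div_pos.2 (mul_pos (by linarith) (by linarith)))
        (Finset.sum_pos' (fun p _ => ?_) ⟨(1, k - 1), ?_, ?_⟩)
      · have : 0 ≤ 1 - α := by linarith
        have := sigmaCoeff_nonneg hα.le p.1
        have := sigmaCoeff_nonneg hα.le p.2
        positivity
      · rw [Finset.HasAntidiagonal.mem_antidiagonal]; dsimp only; omega
      · have h3 := ih 1 (by omega) le_rfl
        have h4 := ih (k - 1) (by omega) (by omega)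
        have h5 : 0 < 1 - α := by linarith
        have h6 : (0 : ℝ) < ((k - 1 : ℕ) : ℝ) := by exact_mod_cast (by omega : 0 < k - 1)
        dsimp only
        positivity

/-- For k = 2 the bracket 2ν - k vanishes at ν = 1; for k > 2 each product contains a factor of
index between 2 and k - 1, zero by induction. -/
theorem sigmaCoeff_one_eq_zero (k : ℕ) (hk : 2 ≤ k) : sigmaCoeff 1 k = 0 := by
  induction k using Nat.strong_induction_on with
  | _ k ih =>
    rw [sigmaCoeff_of_two_le 1 k hk]
    refine mul_eq_zero_of_right _ (Finset.sum_eq_zero fun ν hν => ?_)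
    obtain ⟨h1, h2⟩ := Finset.mem_Ico.1 hν
    rcases Nat.lt_or_ge ν 2 with h | h
    · obtain rfl : ν = 1 := by omega
      rcases eq_or_ne k 2 with rfl | hk2
      · norm_num
      · simp [ih (k - 1) (by omega) (by omega)]
    · simp [ih ν h2 h]

/-- The truncation of the sequence `σ_k` at `k = N`. -/
noncomputable def truncSigma (α : ℝ) (N k : ℕ) : ℝ := if k ≤ N then sigmaCoeff α k else 0

theorem truncSigma_nonneg {α : ℝ} (hα : α ≤ 1) (N k : ℕ) : 0 ≤ truncSigma α N k := by
  unfold truncSigma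
  split_ifs
  exacts [sigmaCoeff_nonneg hα k, le_rfl]

/-- Up to index N nothing has changed and the defect is zero. Beyond N the negative linear term
disappears and only the nonnegative quadratic sum is left. -/
theorem odeDefect_truncSigma_nonneg {α : ℝ} (hα : α ≤ 1) (N k : ℕ) :
    0 ≤ odeDefect α (truncSigma α N) k := by
  by_cases hk : k ≤ N
  · rw [← odeDefect_sigmaCoeff α k]
    unfold odeDefect
    refine le_of_eq ?_
    congr 1
    · refine Finset.sum_congr rfl fun p hp => ?_
      have := Finset.HasAntidiagonal.mem_antidiagonal.1 hp
      rw [truncSigma, truncSigma, if_pos (by omega), if_pos (by omega)]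
    · rw [truncSigma, if_pos hk]
  · have h : truncSigma α N k = 0 := if_neg hk
    rw [odeDefect, h, mul_zero, sub_zero]
    exact sum_antidiagonal_nonneg hα _ _ fun p _ =>
      mul_nonneg (truncSigma_nonneg hα _ _) (truncSigma_nonneg hα _ _)

/-! ### Exponential series: derivatives, products, behaviour at -∞. -/

/-- `∑ k^j t_k e^{ky}`. -/
noncomputable def expSeries (t : ℕ → ℝ) (j : ℕ) (y : ℝ) : ℝ :=
  ∑' k : ℕ, (k : ℝ) ^ j * t k * Real.exp (k * y)

section expSeries

variable {t : ℕ → ℝ} {C y₀ : ℝ}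

theorem norm_expSeries_term_le (hb : ∀ k, |t k| * Real.exp (k * y₀) ≤ C) (j k : ℕ) {y y₁ : ℝ}
    (hy : y ≤ y₁) :
    ‖(k : ℝ) ^ j * t k * Real.exp (k * y)‖ ≤ C * ((k : ℝ) ^ j * Real.exp (y₁ - y₀) ^ k) := by
  have h1 : Real.exp (k * y) ≤ Real.exp (k * y₀) * Real.exp (y₁ - y₀) ^ k := by
    rw [← Real.exp_nat_mul, ← Real.exp_add]
    refine Real.exp_le_exp.2 ?_
    nlinarith [(Nat.cast_nonneg k : (0 : ℝ) ≤ k)]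
  rw [norm_mul, norm_mul, Real.norm_eq_abs, Real.norm_eq_abs, Real.norm_eq_abs, Real.abs_exp,
    abs_of_nonneg (by positivity : (0 : ℝ) ≤ (k : ℝ) ^ j)]
  calc (k : ℝ) ^ j * |t k| * Real.exp (k * y)
      ≤ (k : ℝ) ^ j * |t k| * (Real.exp (k * y₀) * Real.exp (y₁ - y₀) ^ k) := by gcongr
    _ = (|t k| * Real.exp (k * y₀)) * ((k : ℝ) ^ j * Real.exp (y₁ - y₀) ^ k) := by ring
    _ ≤ C * ((k : ℝ) ^ j * Real.exp (y₁ - y₀) ^ k) := by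
      gcongr
      exact hb k

theorem summable_expSeries_bound (C : ℝ) (j : ℕ) {y₁ : ℝ} (hy : y₁ < y₀) :
    Summable fun k : ℕ => C * ((k : ℝ) ^ j * Real.exp (y₁ - y₀) ^ k) := by
  refine (summable_pow_mul_geometric_of_norm_lt_one j ?_).mul_left C
  rw [Real.norm_eq_abs, Real.abs_exp]
  exact Real.exp_zero ▸ Real.exp_lt_exp.2 (by linarith)

theorem summable_norm_expSeries (hb : ∀ k, |t k| * Real.exp (k * y₀) ≤ C) (j : ℕ) {y : ℝ}
    (hy : y < y₀) : Summable fun k : ℕ => ‖(k : ℝ) ^ j * t k * Real.exp (k * y)‖ :=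
  Summable.of_nonneg_of_le (fun _ => norm_nonneg _)
    (fun k => norm_expSeries_term_le hb j k le_rfl) (summable_expSeries_bound C j hy)

theorem hasDerivAt_expSeries (hb : ∀ k, |t k| * Real.exp (k * y₀) ≤ C) (j : ℕ) {y : ℝ}
    (hy : y < y₀) : HasDerivAt (expSeries t j) (expSeries t (j + 1) y) y := by
  obtain ⟨y₁, h1, h2⟩ := exists_between hy
  refine hasDerivAt_tsum_of_isPreconnected
    (g := fun (k : ℕ) y => (k : ℝ) ^ j * t k * Real.exp (k * y))
    (g' := fun (k : ℕ) y => (k : ℝ) ^ (j + 1) * t k * Real.exp (k * y))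
    (summable_expSeries_bound C (j + 1) h2) isOpen_Iio isPreconnected_Iio (fun k z _ => ?_)
    (fun k z hz => norm_expSeries_term_le hb (j + 1) k (le_of_lt hz)) h1
    (summable_norm_expSeries hb j hy).of_norm h1
  have h := (((hasDerivAt_id z).const_mul (k : ℝ)).exp).const_mul ((k : ℝ) ^ j * t k)
  refine h.congr_deriv ?_
  simp only [id]
  ring

/-- The term k = 1 dominates at -∞. This asymptotic normalization replaces an initial condition. -/
theorem tendsto_exp_neg_mul_expSeries (hb : ∀ k, |t k| * Real.exp (k * y₀) ≤ C) (h0 : t 0 = 0)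
    (j : ℕ) : Tendsto (fun y => Real.exp (-y) * expSeries t j y) atBot (𝓝 (t 1)) := by
  obtain ⟨y₁, h1⟩ := exists_lt y₀
  have key : Tendsto (fun y => ∑' k : ℕ, (k : ℝ) ^ j * t k * Real.exp (((k : ℝ) - 1) * y)) atBot
      (𝓝 (∑' k : ℕ, if k = 1 then t 1 else 0)) := by
    refine tendsto_tsum_of_dominated_convergence
      (bound := fun k : ℕ => Real.exp (-y₁) * (C * ((k : ℝ) ^ j * Real.exp (y₁ - y₀) ^ k)))
      ((summable_expSeries_bound C j h1).mul_left _) (fun k => ?_) ?_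
    · rcases k with _ | _ | k
      · simp [h0]
      · simp
      · rw [if_neg (by omega)]
        have : Tendsto (fun y : ℝ => (((k + 1 + 1 : ℕ) : ℝ) - 1) * y) atBot atBot :=
          tendsto_id.const_mul_atBot (by push_cast; linarith [(Nat.cast_nonneg k : (0 : ℝ) ≤ k)])
        simpa using (Real.tendsto_exp_atBot.comp this).const_mul
          (((k + 1 + 1 : ℕ) : ℝ) ^ j * t (k + 1 + 1))
    · filter_upwards [eventually_le_atBot y₁] with y hy k
      -- For k = 0 the exponential is e^{-y}, unbounded at -∞; only t 0 = 0 saves the domination.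
      rcases k with _ | k
      · simp only [h0, mul_zero, zero_mul, norm_zero]
        have := (norm_nonneg _).trans (norm_expSeries_term_le hb j 0 hy)
        positivity
      · have h2 := norm_expSeries_term_le hb j (k + 1) (le_refl y₁)
        rw [norm_mul, Real.norm_eq_abs (Real.exp _), Real.abs_exp] at h2 ⊢
        have h3 : Real.exp ((((k + 1 : ℕ) : ℝ) - 1) * y)
            ≤ Real.exp (-y₁) * Real.exp (((k + 1 : ℕ) : ℝ) * y₁) := by
          rw [← Real.exp_add]
          refine Real.exp_le_exp.2 ?_
          push_cast
          nlinarith [(Nat.cast_nonneg k : (0 : ℝ) ≤ k)]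
        calc _ ≤ ‖((k + 1 : ℕ) : ℝ) ^ j * t (k + 1)‖ *
              (Real.exp (-y₁) * Real.exp (((k + 1 : ℕ) : ℝ) * y₁)) := by gcongr
          _ = Real.exp (-y₁) * (‖((k + 1 : ℕ) : ℝ) ^ j * t (k + 1)‖ *
              Real.exp (((k + 1 : ℕ) : ℝ) * y₁)) := by ring
          _ ≤ _ := by gcongr
  rw [tsum_ite_eq] at key
  refine key.congr fun y => ?_
  rw [expSeries, ← tsum_mul_left]
  refine tsum_congr fun k => ?_
  rw [sub_mul, one_mul, sub_eq_add_neg, Real.exp_add]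
  ring

theorem tendsto_expSeries_atBot (hb : ∀ k, |t k| * Real.exp (k * y₀) ≤ C) (h0 : t 0 = 0)
    (j : ℕ) : Tendsto (expSeries t j) atBot (𝓝 0) := by
  have h := (tendsto_exp_neg_mul_expSeries hb h0 j).mul Real.tendsto_exp_atBot
  rw [mul_zero] at h
  refine h.congr fun y => ?_
  rw [mul_right_comm, ← Real.exp_add, neg_add_cancel, Real.exp_zero, one_mul]

theorem expSeries_mul_expSeries (hb : ∀ k, |t k| * Real.exp (k * y₀) ≤ C) (i j : ℕ) {y : ℝ}
    (hy : y < y₀) :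
    HasSum (fun k : ℕ => (∑ p ∈ Finset.HasAntidiagonal.antidiagonal k,
      t p.1 * t p.2 * ((p.1 : ℝ) ^ i * (p.2 : ℝ) ^ j)) * Real.exp (k * y))
      (expSeries t i y * expSeries t j y) := by
  have hi := summable_norm_expSeries hb i hy
  have hj := summable_norm_expSeries hb j hy
  rw [expSeries, expSeries, tsum_mul_tsum_eq_tsum_sum_antidiagonal_of_summable_norm hi hj]
  have hs := (summable_norm_sum_mul_antidiagonal_of_summable_norm hi hj).of_norm
  refine hs.hasSum.congr_fun fun k => ?_
  rw [Finset.sum_mul]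
  refine Finset.sum_congr rfl fun p hp => ?_
  rw [← Finset.HasAntidiagonal.mem_antidiagonal.1 hp, Nat.cast_add, add_mul, Real.exp_add]
  ring

theorem expSeries_ode_defect (hb : ∀ k, |t k| * Real.exp (k * y₀) ≤ C) (α : ℝ) {y : ℝ}
    (hy : y < y₀) :
    HasSum (fun k : ℕ => odeDefect α t k * Real.exp (k * y))
      (expSeries t 0 y * expSeries t 2 y - α * expSeries t 1 y ^ 2
        - expSeries t 2 y + expSeries t 1 y) := by
  have h02 := expSeries_mul_expSeries hb 0 2 hy
  have h11 := (expSeries_mul_expSeries hb 1 1 hy).mul_left α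
  have h2 := (summable_norm_expSeries hb 2 hy).of_norm.hasSum
  have h1 := (summable_norm_expSeries hb 1 hy).of_norm.hasSum
  rw [sq (expSeries t 1 y)]
  refine (((h02.sub h11).sub h2).add h1).congr_fun fun k => ?_
  rw [odeDefect, ← mul_assoc, ← sub_mul, ← sub_mul, ← add_mul, Finset.mul_sum,
    ← Finset.sum_sub_distrib, sub_add]
  congr 2
  · refine Finset.sum_congr rfl fun p _ => ?_
    ring
  · ring

end expSeries

/-! ### The potential that separates the variables. -/

section logPotential

/-- The primitive `∫₀^w (1 - x ^ ((1 - α) / α)) / (1 - x) dx + log (1 - w)` of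
`-w ^ ((1 - α) / α) / (1 - w)`. -/
noncomputable def logPotential (α w : ℝ) : ℝ :=
  (∫ x in (0 : ℝ)..w, (1 - x ^ ((1 - α) / α)) / (1 - x)) + Real.log (1 - w)

theorem logPotential_zero (α : ℝ) : logPotential α 0 = 0 := by
  simp [logPotential]

theorem log_gammaConst {α : ℝ} (hα : 0 < α) :
    Real.log (gammaConst α) =
      -((∫ x in (0 : ℝ)..1, (1 - x ^ ((1 - α) / α)) / (1 - x)) + Real.log α) := by
  rw [gammaConst, Real.log_mul (by positivity) (Real.exp_ne_zero _), Real.log_exp, one_div,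
    Real.log_inv]
  ring

theorem gammaConst_pos {α : ℝ} (hα : 0 < α) : 0 < gammaConst α := by
  unfold gammaConst
  positivity

/-- Bernoulli's inequality handles β ≥ 1, and x ≤ x^β handles β ≤ 1. The singularity at 1 is thus
removable as far as integrability is concerned; at x = 1 the quotient has the default value 0. -/
theorem one_sub_rpow_div_one_sub_mem_Icc {β x : ℝ} (hβ : 0 ≤ β) (hx : x ∈ Icc (0 : ℝ) 1) :
    (1 - x ^ β) / (1 - x) ∈ Icc 0 (max 1 β) := by
  obtain ⟨h0, h1⟩ := hx
  rcases h1.eq_or_lt with rfl | h1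
  · simp
  have hx1 : 0 < 1 - x := by linarith
  refine ⟨div_nonneg (by linarith [Real.rpow_le_one h0 h1.le hβ]) hx1.le, ?_⟩
  rw [div_le_iff₀ hx1]
  rcases le_total 1 β with h | h
  · have := one_add_mul_self_le_rpow_one_add (s := x - 1) (by linarith) h
    rw [add_sub_cancel] at this
    rw [max_eq_right h]
    linarith
  · have := Real.rpow_le_rpow_of_exponent_ge' h0 h1.le hβ h
    rw [Real.rpow_one] at this
    rw [max_eq_left h]
    linarith

variable {α : ℝ}

theorem integrableOn_one_sub_rpow_div (hα0 : 0 < α) (hα : α ≤ 1) :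
    IntegrableOn (fun x : ℝ => (1 - x ^ ((1 - α) / α)) / (1 - x)) (Icc 0 1) := by
  have hβ : 0 ≤ (1 - α) / α := div_nonneg (by linarith) hα0.le
  refine Measure.integrableOn_of_bounded (M := max 1 ((1 - α) / α)) (by simp)
    (Measurable.aestronglyMeasurable (by fun_prop)) ?_
  filter_upwards [ae_restrict_mem measurableSet_Icc] with x hx
  have := one_sub_rpow_div_one_sub_mem_Icc hβ hx
  rw [Real.norm_eq_abs, abs_of_nonneg this.1]
  exact this.2

theorem continuousOn_primitive_one_sub_rpow_div (hα0 : 0 < α) (hα : α ≤ 1) :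
    ContinuousOn (fun w => ∫ x in (0 : ℝ)..w, (1 - x ^ ((1 - α) / α)) / (1 - x)) (Icc 0 1) := by
  have h := intervalIntegral.continuousOn_primitive_interval (a := 0) (b := 1)
    (f := fun x : ℝ => (1 - x ^ ((1 - α) / α)) / (1 - x)) (μ := volume)
    (by rw [uIcc_of_le zero_le_one]; exact integrableOn_one_sub_rpow_div hα0 hα)
  rwa [uIcc_of_le zero_le_one] at h

theorem continuousOn_logPotential (hα0 : 0 < α) (hα : α ≤ 1) :
    ContinuousOn (logPotential α) (Ico 0 1) := by
  refine ((continuousOn_primitive_one_sub_rpow_div hα0 hα).mono Ico_subset_Icc_self).add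
    (ContinuousOn.log (by fun_prop) fun x hx => ?_)
  linarith [hx.2]

theorem hasDerivAt_logPotential (hα0 : 0 < α) (hα : α ≤ 1) {w : ℝ} (hw : w ∈ Ioo (0 : ℝ) 1) :
    HasDerivAt (logPotential α) (-(w ^ ((1 - α) / α)) / (1 - w)) w := by
  have h1 : 1 - w ≠ 0 := by linarith [hw.2]
  have hi : IntervalIntegrable (fun x : ℝ => (1 - x ^ ((1 - α) / α)) / (1 - x)) volume 0 w := by
    rw [intervalIntegrable_iff_integrableOn_Icc_of_le hw.1.le]
    exact (integrableOn_one_sub_rpow_div hα0 hα).mono_set (Icc_subset_Icc_right hw.2.le)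
  have hc : ContinuousAt (fun x : ℝ => (1 - x ^ ((1 - α) / α)) / (1 - x)) w :=
    (continuousAt_const.sub (Real.continuousAt_rpow_const _ _ (Or.inl hw.1.ne'))).div
      (by fun_prop) h1
  have hm : StronglyMeasurable (fun x : ℝ => (1 - x ^ ((1 - α) / α)) / (1 - x)) :=
    Measurable.stronglyMeasurable (by fun_prop)
  refine ((intervalIntegral.integral_hasDerivAt_right hi
    hm.stronglyMeasurableAtFilter hc).add
      (((hasDerivAt_id w).const_sub 1).log h1)).congr_deriv ?_
  simp only [id]
  field_simp
  ring

theorem strictAntiOn_logPotential (hα0 : 0 < α) (hα : α ≤ 1) :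
    StrictAntiOn (logPotential α) (Ico 0 1) := by
  refine strictAntiOn_of_deriv_neg (convex_Ico 0 1) (continuousOn_logPotential hα0 hα) ?_
  rw [interior_Ico]
  intro w hw
  rw [(hasDerivAt_logPotential hα0 hα hw).deriv]
  have := Real.rpow_pos_of_pos hw.1 ((1 - α) / α)
  exact div_neg_of_neg_of_pos (by linarith) (by linarith [hw.2])

end logPotential

/-- The comparison principle with initial data at -∞; applied to f and to -f it also yields
equalities. -/
theorem le_of_hasDerivAt_nonneg_of_tendsto_atBot {f f' : ℝ → ℝ} {y₁ l : ℝ}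
    (hf : ∀ y < y₁, HasDerivAt f (f' y) y) (hf' : ∀ y < y₁, 0 ≤ f' y)
    (hl : Tendsto f atBot (𝓝 l)) {y : ℝ} (hy : y < y₁) : l ≤ f y := by
  have hmono : MonotoneOn f (Iio y₁) := by
    refine monotoneOn_of_deriv_nonneg (convex_Iio y₁)
      (fun z hz => (hf z hz).continuousAt.continuousWithinAt) ?_ ?_ <;> rw [interior_Iio]
    · exact fun z hz => (hf z hz).differentiableAt.differentiableWithinAt
    · intro z hz
      rw [(hf z hz).deriv]
      exact hf' z hz
  refine le_of_tendsto hl ?_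
  filter_upwards [eventually_le_atBot y] with z hz
  exact hmono (hz.trans_lt hy) hy hz

/-! ### The two integrations of the second-order equation. -/

section firstIntegral

variable {α : ℝ} {A₀ A₁ A₂ : ℝ → ℝ}

/-- The integrating factor α(1 - A₀)^(-α-1) turns the second-order expression into an exact
derivative. -/
theorem hasDerivAt_firstIntegral {y : ℝ} (h0 : HasDerivAt A₀ (A₁ y) y)
    (h1 : HasDerivAt A₁ (A₂ y) y) (hlt : A₀ y < 1) :
    HasDerivAt (fun z => (1 - α * A₁ z) * (1 - A₀ z) ^ (-α))
      (α * (A₀ y * A₂ y - α * A₁ y ^ 2 - A₂ y + A₁ y) * (1 - A₀ y) ^ (-α - 1)) y := by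
  have hpos : 0 < 1 - A₀ y := by linarith
  refine (((h1.const_mul α).const_sub 1).mul
    ((h0.const_sub 1).rpow_const (p := -α) (Or.inl hpos.ne'))).congr_deriv ?_
  have : (1 - A₀ y) ^ (-α) = (1 - A₀ y) ^ (-α - 1) * (1 - A₀ y) := by
    rw [← Real.rpow_add_one hpos.ne', sub_add_cancel]
  rw [this]
  ring

theorem tendsto_firstIntegral (h0 : Tendsto A₀ atBot (𝓝 0)) (h1 : Tendsto A₁ atBot (𝓝 0)) :
    Tendsto (fun z => (1 - α * A₁ z) * (1 - A₀ z) ^ (-α)) atBot (𝓝 1) := by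
  have h2 : Tendsto (fun z => 1 - α * A₁ z) atBot (𝓝 1) := by
    simpa using (h1.const_mul α).const_sub 1
  have h3 : Tendsto (fun z => 1 - A₀ z) atBot (𝓝 1) := by simpa using h0.const_sub 1
  simpa using h2.mul (h3.rpow_const (p := -α) (Or.inl one_ne_zero))

/-- With w = (1 - A₀)^α, the factor w^((1-α)/α) = (1 - A₀)^(1-α) cancels the power produced by
differentiating w. -/
theorem hasDerivAt_logPotential_comp (hα0 : 0 < α) (hα : α ≤ 1) {y : ℝ}
    (h0 : HasDerivAt A₀ (A₁ y) y) (hmem : A₀ y ∈ Ioo 0 1) :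
    HasDerivAt (fun z => logPotential α ((1 - A₀ z) ^ α) - z)
      (α * A₁ y / (1 - (1 - A₀ y) ^ α) - 1) y := by
  have hpos : 0 < 1 - A₀ y := by linarith [hmem.2]
  have hw0 : 0 < (1 - A₀ y) ^ α := Real.rpow_pos_of_pos hpos α
  have hw1 : (1 - A₀ y) ^ α < 1 := Real.rpow_lt_one hpos.le (by linarith [hmem.1]) hα0
  refine (((hasDerivAt_logPotential hα0 hα ⟨hw0, hw1⟩).comp y
    ((h0.const_sub 1).rpow_const (p := α) (Or.inl hpos.ne'))).sub (hasDerivAt_id y)).congr_deriv ?_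
  rw [← Real.rpow_mul hpos.le, mul_div_cancel₀ _ hα0.ne']
  have h : (1 - A₀ y) ^ (1 - α) * (1 - A₀ y) ^ (α - 1) = 1 := by
    rw [← Real.rpow_add hpos]; simp
  have hw : 1 - (1 - A₀ y) ^ α ≠ 0 := by linarith
  field_simp
  linear_combination (α * A₁ y) * h

theorem tendsto_one_sub_rpow_div (α : ℝ) :
    Tendsto (fun u : ℝ => (1 - (1 - u) ^ α) / u) (𝓝[≠] 0) (𝓝 α) := by
  have h : HasDerivAt (fun u : ℝ => 1 - (1 - u) ^ α) α 0 := by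
    refine ((((hasDerivAt_id (0 : ℝ)).const_sub 1).rpow_const (p := α)
      (Or.inl (by simp))).const_sub 1).congr_deriv ?_
    simp
  refine h.tendsto_slope.congr fun u => ?_
  simp [slope_def_field]

/-- This is where γ_α arises: 1 - w ~ α A₀ ~ α e^y, so log (1 - w) - y tends to log α, while the
integral tends to its value over [0, 1]. -/
theorem tendsto_logPotential_comp (hα0 : 0 < α) (hα : α ≤ 1) (h0 : Tendsto A₀ atBot (𝓝 0))
    (h1 : Tendsto (fun y => Real.exp (-y) * A₀ y) atBot (𝓝 1))
    (hmem : ∀ᶠ y in atBot, A₀ y ∈ Ioo 0 1) :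
    Tendsto (fun z => logPotential α ((1 - A₀ z) ^ α) - z) atBot
      (𝓝 (-Real.log (gammaConst α))) := by
  have hw : Tendsto (fun z => (1 - A₀ z) ^ α) atBot (𝓝[Icc 0 1] 1) := by
    refine tendsto_nhdsWithin_iff.2 ⟨?_, ?_⟩
    · have h3 : Tendsto (fun z => 1 - A₀ z) atBot (𝓝 1) := by simpa using h0.const_sub 1
      simpa using h3.rpow_const (p := α) (Or.inl one_ne_zero)
    · filter_upwards [hmem] with y hy
      have hpos : 0 ≤ 1 - A₀ y := by linarith [hy.2]
      exact ⟨Real.rpow_nonneg hpos α, Real.rpow_le_one hpos (by linarith [hy.1]) hα0.le⟩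
  have hH := (continuousOn_primitive_one_sub_rpow_div hα0 hα 1 ⟨zero_le_one, le_rfl⟩).tendsto.comp
    hw
  have hA : Tendsto A₀ atBot (𝓝[≠] 0) := tendsto_nhdsWithin_iff.2
    ⟨h0, by filter_upwards [hmem] with y hy using hy.1.ne'⟩
  have hq := (((tendsto_one_sub_rpow_div α).comp hA).mul h1).log (by simpa using hα0.ne')
  rw [log_gammaConst hα0, neg_neg]
  rw [mul_one] at hq
  refine (hH.add hq).congr' ?_
  filter_upwards [hmem] with y hy
  have hpos : 0 < 1 - A₀ y := by linarith [hy.2]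
  have hw1 : (1 - A₀ y) ^ α < 1 := Real.rpow_lt_one hpos.le (by linarith [hy.1]) hα0
  have : (1 - (1 - A₀ y) ^ α) / A₀ y * (Real.exp (-y) * A₀ y)
      = (1 - (1 - A₀ y) ^ α) * Real.exp (-y) := by
    have := hy.1.ne'
    field_simp
  simp only [Function.comp, logPotential, this]
  rw [Real.log_mul (by linarith) (Real.exp_ne_zero _), Real.log_exp]
  ring

variable {y₁ : ℝ}

theorem mul_le_one_sub_rpow_of_nonneg
    (hd0 : ∀ y < y₁, HasDerivAt A₀ (A₁ y) y) (hd1 : ∀ y < y₁, HasDerivAt A₁ (A₂ y) y)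
    (hα0 : 0 < α) (hmem : ∀ y < y₁, A₀ y ∈ Ioo 0 1)
    (h0 : Tendsto A₀ atBot (𝓝 0)) (h1 : Tendsto A₁ atBot (𝓝 0))
    (hE : ∀ y < y₁, 0 ≤ A₀ y * A₂ y - α * A₁ y ^ 2 - A₂ y + A₁ y) {y : ℝ} (hy : y < y₁) :
    α * A₁ y ≤ 1 - (1 - A₀ y) ^ α := by
  have h := le_of_hasDerivAt_nonneg_of_tendsto_atBot
    (fun z hz => hasDerivAt_firstIntegral (α := α) (hd0 z hz) (hd1 z hz) (hmem z hz).2)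
    (fun z hz => mul_nonneg (mul_nonneg hα0.le (hE z hz))
      (Real.rpow_nonneg (by linarith [(hmem z hz).2]) _)) (tendsto_firstIntegral h0 h1) hy
  have hpos : 0 < 1 - A₀ y := by linarith [(hmem y hy).2]
  rw [Real.rpow_neg hpos.le, ← div_eq_mul_inv, le_div_iff₀ (Real.rpow_pos_of_pos hpos α)] at h
  linarith

theorem mul_eq_one_sub_rpow_of_eq_zero
    (hd0 : ∀ y < y₁, HasDerivAt A₀ (A₁ y) y) (hd1 : ∀ y < y₁, HasDerivAt A₁ (A₂ y) y)
    (hα0 : 0 < α) (hmem : ∀ y < y₁, A₀ y ∈ Ioo 0 1)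
    (h0 : Tendsto A₀ atBot (𝓝 0)) (h1 : Tendsto A₁ atBot (𝓝 0))
    (hE : ∀ y < y₁, A₀ y * A₂ y - α * A₁ y ^ 2 - A₂ y + A₁ y = 0) {y : ℝ} (hy : y < y₁) :
    α * A₁ y = 1 - (1 - A₀ y) ^ α := by
  refine le_antisymm
    (mul_le_one_sub_rpow_of_nonneg hd0 hd1 hα0 hmem h0 h1 (fun z hz => (hE z hz).ge) hy) ?_
  have h := le_of_hasDerivAt_nonneg_of_tendsto_atBot
    (fun z hz => (hasDerivAt_firstIntegral (α := α) (hd0 z hz) (hd1 z hz) (hmem z hz).2).neg)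
    (fun z hz => by rw [hE z hz]; simp) (tendsto_firstIntegral h0 h1).neg hy
  have hpos : 0 < 1 - A₀ y := by linarith [(hmem y hy).2]
  replace h : (1 - α * A₁ y) * (1 - A₀ y) ^ (-α) ≤ 1 := neg_le_neg_iff.1 h
  rw [Real.rpow_neg hpos.le, ← div_eq_mul_inv, div_le_iff₀ (Real.rpow_pos_of_pos hpos α)] at h
  linarith

theorem logPotential_comp_le (hα0 : 0 < α) (hα : α ≤ 1)
    (hd0 : ∀ y < y₁, HasDerivAt A₀ (A₁ y) y) (hmem : ∀ y < y₁, A₀ y ∈ Ioo 0 1)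
    (h0 : Tendsto A₀ atBot (𝓝 0)) (h1 : Tendsto (fun y => Real.exp (-y) * A₀ y) atBot (𝓝 1))
    (hle : ∀ y < y₁, α * A₁ y ≤ 1 - (1 - A₀ y) ^ α) {y : ℝ} (hy : y < y₁) :
    logPotential α ((1 - A₀ y) ^ α) ≤ y - Real.log (gammaConst α) := by
  have h := le_of_hasDerivAt_nonneg_of_tendsto_atBot
    (fun z hz => (hasDerivAt_logPotential_comp hα0 hα (hd0 z hz) (hmem z hz)).neg)
    (fun z hz => ?_) (tendsto_logPotential_comp hα0 hα h0 h1
      ((eventually_lt_atBot y₁).mono hmem)).neg hy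
  · simp only [Pi.neg_apply] at h
    linarith
  · have hpos : 0 < 1 - A₀ z := by linarith [(hmem z hz).2]
    have hw1 : (1 - A₀ z) ^ α < 1 := Real.rpow_lt_one hpos.le (by linarith [(hmem z hz).1]) hα0
    have := div_le_one_of_le₀ (hle z hz) (by linarith)
    linarith

theorem logPotential_comp_eq (hα0 : 0 < α) (hα : α ≤ 1)
    (hd0 : ∀ y < y₁, HasDerivAt A₀ (A₁ y) y) (hmem : ∀ y < y₁, A₀ y ∈ Ioo 0 1)
    (h0 : Tendsto A₀ atBot (𝓝 0)) (h1 : Tendsto (fun y => Real.exp (-y) * A₀ y) atBot (𝓝 1))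
    (heq : ∀ y < y₁, α * A₁ y = 1 - (1 - A₀ y) ^ α) {y : ℝ} (hy : y < y₁) :
    logPotential α ((1 - A₀ y) ^ α) = y - Real.log (gammaConst α) := by
  refine le_antisymm
    (logPotential_comp_le hα0 hα hd0 hmem h0 h1 (fun z hz => (heq z hz).le) hy) ?_
  have h := le_of_hasDerivAt_nonneg_of_tendsto_atBot
    (fun z hz => hasDerivAt_logPotential_comp hα0 hα (hd0 z hz) (hmem z hz))
    (fun z hz => ?_) (tendsto_logPotential_comp hα0 hα h0 h1
      ((eventually_lt_atBot y₁).mono hmem)) hy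
  · linarith
  · have hpos : 0 < 1 - A₀ z := by linarith [(hmem z hz).2]
    have hw1 : (1 - A₀ z) ^ α < 1 := Real.rpow_lt_one hpos.le (by linarith [(hmem z hz).1]) hα0
    rw [heq z hz, div_self (by linarith), sub_self]

end firstIntegral

/-! ### The barrier for series with nonnegative defect. -/

section nonneg

variable {t : ℕ → ℝ} {C y₀ : ℝ}

theorem exp_le_expSeries (hb : ∀ k, |t k| * Real.exp (k * y₀) ≤ C) (ht : ∀ k, 0 ≤ t k)
    (h1 : t 1 = 1) (j : ℕ) {y : ℝ} (hy : y < y₀) : Real.exp y ≤ expSeries t j y := by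
  have h := (summable_norm_expSeries hb j hy).of_norm.le_tsum 1
    (fun k _ => by have := ht k; positivity)
  simpa [h1, expSeries] using h

theorem strictMonoOn_expSeries (hb : ∀ k, |t k| * Real.exp (k * y₀) ≤ C) (ht : ∀ k, 0 ≤ t k)
    (h1 : t 1 = 1) (j : ℕ) : StrictMonoOn (expSeries t j) (Iio y₀) := by
  refine strictMonoOn_of_deriv_pos (convex_Iio y₀)
    (fun z hz => (hasDerivAt_expSeries hb j hz).continuousAt.continuousWithinAt) ?_
  rw [interior_Iio]
  intro z hz
  rw [(hasDerivAt_expSeries hb j hz).deriv]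
  exact (Real.exp_pos z).trans_le (exp_le_expSeries hb ht h1 (j + 1) hz)

/-- If the series first reached 1 at some y₁ < log γ_α, then w would tend to 0 there and the bound
on `logPotential` would give 0 ≤ y₁ - log γ_α in the limit, which is absurd. -/
theorem expSeries_lt_one_of_odeDefect_nonneg {α : ℝ} (hα0 : 0 < α) (hα : α ≤ 1)
    (hb : ∀ k, |t k| * Real.exp (k * Real.log (gammaConst α)) ≤ C) (ht : ∀ k, 0 ≤ t k)
    (h0 : t 0 = 0) (h1 : t 1 = 1) (hE : ∀ k, 0 ≤ odeDefect α t k) {y : ℝ}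
    (hy : y < Real.log (gammaConst α)) : expSeries t 0 y < 1 := by
  by_contra! hge
  have hcont : ContinuousOn (expSeries t 0) (Iio (Real.log (gammaConst α))) :=
    fun z hz => (hasDerivAt_expSeries hb 0 hz).continuousAt.continuousWithinAt
  have hlim := tendsto_expSeries_atBot hb h0 0
  obtain ⟨z, hz, hzy⟩ := ((hlim.eventually_lt_const zero_lt_one).and (eventually_le_atBot y)).exists
  obtain ⟨y₁, hy₁, hval⟩ := intermediate_value_Icc hzy
    (hcont.mono fun x hx => hx.2.trans_lt hy) ⟨hz.le, hge⟩
  have hy₁γ : y₁ < Real.log (gammaConst α) := hy₁.2.trans_lt hy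
  have hmem : ∀ x < y₁, expSeries t 0 x ∈ Ioo 0 1 := fun x hx =>
    ⟨(Real.exp_pos x).trans_le (exp_le_expSeries hb ht h1 0 (hx.trans hy₁γ)),
      hval ▸ strictMonoOn_expSeries hb ht h1 0 (hx.trans hy₁γ) hy₁γ hx⟩
  have hle : ∀ x < y₁, logPotential α ((1 - expSeries t 0 x) ^ α)
      ≤ x - Real.log (gammaConst α) := fun x hx =>
    logPotential_comp_le hα0 hα (fun z hz => hasDerivAt_expSeries hb 0 (hz.trans hy₁γ)) hmem hlim
      (h1 ▸ tendsto_exp_neg_mul_expSeries hb h0 0)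
      (fun z hz => mul_le_one_sub_rpow_of_nonneg
        (fun z hz => hasDerivAt_expSeries hb 0 (hz.trans hy₁γ))
        (fun z hz => hasDerivAt_expSeries hb 1 (hz.trans hy₁γ)) hα0 hmem hlim
        (tendsto_expSeries_atBot hb h0 1)
        (fun x hx => (expSeries_ode_defect hb α (hx.trans hy₁γ)).nonneg fun k =>
          mul_nonneg (hE k) (Real.exp_pos _).le) hz) hx
  have hw : Tendsto (fun x => (1 - expSeries t 0 x) ^ α) (𝓝[<] y₁) (𝓝[Ico 0 1] 0) := by
    refine tendsto_nhdsWithin_iff.2 ⟨?_, ?_⟩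
    · have h2 : Tendsto (fun x => 1 - expSeries t 0 x) (𝓝[<] y₁) (𝓝 0) := by
        have := ((hasDerivAt_expSeries hb 0 hy₁γ).continuousAt.tendsto.mono_left
          (nhdsWithin_le_nhds (s := Iio y₁))).const_sub 1
        rwa [hval, sub_self] at this
      simpa [Real.zero_rpow hα0.ne'] using h2.rpow_const (p := α) (Or.inr hα0.le)
    · filter_upwards [self_mem_nhdsWithin] with x hx
      have := hmem x hx
      exact ⟨Real.rpow_nonneg (by linarith [this.2]) α,
        Real.rpow_lt_one (by linarith [this.2]) (by linarith [this.1]) hα0⟩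
  have hL := (continuousOn_logPotential hα0 hα 0 ⟨le_rfl, zero_lt_one⟩).tendsto.comp hw
  rw [logPotential_zero] at hL
  have hR : Tendsto (fun x => x - Real.log (gammaConst α)) (𝓝[<] y₁)
      (𝓝 (y₁ - Real.log (gammaConst α))) :=
    (tendsto_id.mono_left nhdsWithin_le_nhds).sub_const _
  have := le_of_tendsto_of_tendsto hL hR (by
    filter_upwards [self_mem_nhdsWithin] with x hx using hle x hx)
  linarith

end nonneg

/-! ### Convergence up to log γ_α and the value at the endpoint. -/

section sigma

variable {α : ℝ}

theorem exp_mul_log_gammaConst (hα0 : 0 < α) (k : ℕ) :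
    Real.exp (k * Real.log (gammaConst α)) = gammaConst α ^ k := by
  rw [Real.exp_nat_mul, Real.exp_log (gammaConst_pos hα0)]

theorem expSeries_truncSigma (α : ℝ) (N : ℕ) (y : ℝ) :
    expSeries (truncSigma α N) 0 y =
      ∑ k ∈ Finset.range (N + 1), sigmaCoeff α k * Real.exp (k * y) := by
  rw [expSeries, tsum_eq_sum (s := Finset.range (N + 1))]
  · refine Finset.sum_congr rfl fun k hk => ?_
    rw [truncSigma, if_pos (Nat.lt_succ_iff.1 (Finset.mem_range.1 hk)), pow_zero, one_mul]
  · intro k hk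
    rw [truncSigma, if_neg (fun h => hk (Finset.mem_range.2 (Nat.lt_succ_iff.2 h)))]
    simp

theorem sum_range_sigmaCoeff_lt_one (hα0 : 0 < α) (hα : α ≤ 1) (N : ℕ) {y : ℝ}
    (hy : y < Real.log (gammaConst α)) :
    ∑ k ∈ Finset.range (N + 2), sigmaCoeff α k * Real.exp (k * y) < 1 := by
  rw [← expSeries_truncSigma]
  -- The range N + 2 corresponds to truncation at N + 1 ≥ 1, which retains σ_1 = 1. The constant C
  -- is the whole finite sum at the endpoint, which dominates each of its terms.
  refine expSeries_lt_one_of_odeDefect_nonneg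
    (C := ∑ k ∈ Finset.range (N + 2), sigmaCoeff α k * Real.exp (k * Real.log (gammaConst α)))
    hα0 hα (fun k => ?_) (truncSigma_nonneg hα (N + 1)) ?_ ?_
    (odeDefect_truncSigma_nonneg hα (N + 1)) hy
  · rw [abs_of_nonneg (truncSigma_nonneg hα _ _), truncSigma]
    have hnn : ∀ k, 0 ≤ sigmaCoeff α k * Real.exp (k * Real.log (gammaConst α)) := fun k =>
      mul_nonneg (sigmaCoeff_nonneg hα k) (Real.exp_pos _).le
    split_ifs with h
    · exact Finset.single_le_sum
        (f := fun k : ℕ => sigmaCoeff α k * Real.exp (k * Real.log (gammaConst α)))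
        (fun k _ => hnn k) (Finset.mem_range.2 (by omega))
    · rw [zero_mul]
      exact Finset.sum_nonneg fun k _ => hnn k
  · simp [truncSigma, sigmaCoeff_zero]
  · simp [truncSigma, sigmaCoeff_one]

theorem sum_range_sigmaCoeff_le_one (hα0 : 0 < α) (hα : α ≤ 1) (N : ℕ) {y : ℝ}
    (hy : y ≤ Real.log (gammaConst α)) :
    ∑ k ∈ Finset.range N, sigmaCoeff α k * Real.exp (k * y) ≤ 1 := by
  have h2 : ∑ k ∈ Finset.range (N + 2), sigmaCoeff α k * Real.exp (k * y) ≤ 1 := by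
    have hc : Continuous fun y => ∑ k ∈ Finset.range (N + 2),
      sigmaCoeff α k * Real.exp (k * y) := by fun_prop
    refine le_of_tendsto (hc.continuousAt.tendsto.mono_left (nhdsWithin_le_nhds (s := Iio y))) ?_
    filter_upwards [self_mem_nhdsWithin] with x hx
    exact (sum_range_sigmaCoeff_lt_one hα0 hα N (lt_of_lt_of_le hx hy)).le
  refine le_trans (Finset.sum_le_sum_of_subset_of_nonneg (Finset.range_mono (by omega))
    fun k _ _ => ?_) h2
  exact mul_nonneg (sigmaCoeff_nonneg hα k) (Real.exp_pos _).le

theorem sigmaCoeff_bound (hα0 : 0 < α) (hα : α ≤ 1) (k : ℕ) :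
    |sigmaCoeff α k| * Real.exp (k * Real.log (gammaConst α)) ≤ 1 := by
  rw [abs_of_nonneg (sigmaCoeff_nonneg hα k)]
  refine le_trans ?_ (sum_range_sigmaCoeff_le_one hα0 hα (k + 1) le_rfl)
  exact Finset.single_le_sum
    (f := fun k : ℕ => sigmaCoeff α k * Real.exp (k * Real.log (gammaConst α)))
    (fun k _ => mul_nonneg (sigmaCoeff_nonneg hα k) (Real.exp_pos _).le)
    (Finset.mem_range.2 (by omega))

theorem summable_sigmaCoeff (hα0 : 0 < α) (hα : α ≤ 1) {y : ℝ}
    (hy : y ≤ Real.log (gammaConst α)) :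
    Summable fun k : ℕ => sigmaCoeff α k * Real.exp (k * y) :=
  summable_of_sum_range_le (fun k => mul_nonneg (sigmaCoeff_nonneg hα k) (Real.exp_pos _).le)
    fun N => sum_range_sigmaCoeff_le_one hα0 hα N hy

theorem hasSum_sigmaCoeff (hα0 : 0 < α) (hα : α ≤ 1) {y : ℝ}
    (hy : y ≤ Real.log (gammaConst α)) :
    HasSum (fun k : ℕ => sigmaCoeff α k * Real.exp (k * y)) (expSeries (sigmaCoeff α) 0 y) := by
  simpa [expSeries] using (summable_sigmaCoeff hα0 hα hy).hasSum

theorem expSeries_sigmaCoeff_le_one (hα0 : 0 < α) (hα : α ≤ 1) {y : ℝ}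
    (hy : y ≤ Real.log (gammaConst α)) : expSeries (sigmaCoeff α) 0 y ≤ 1 := by
  rw [← (hasSum_sigmaCoeff hα0 hα hy).tsum_eq]
  exact Real.tsum_le_of_sum_range_le
    (fun k => mul_nonneg (sigmaCoeff_nonneg hα k) (Real.exp_pos _).le)
    fun N => sum_range_sigmaCoeff_le_one hα0 hα N hy

theorem expSeries_sigmaCoeff_mem_Ioo (hα0 : 0 < α) (hα : α ≤ 1) {y : ℝ}
    (hy : y < Real.log (gammaConst α)) : expSeries (sigmaCoeff α) 0 y ∈ Ioo 0 1 := by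
  have hb := sigmaCoeff_bound hα0 hα
  have hσ := sigmaCoeff_nonneg hα
  obtain ⟨y', h1, h2⟩ := exists_between hy
  exact ⟨(Real.exp_pos y).trans_le (exp_le_expSeries hb hσ (sigmaCoeff_one α) 0 hy),
    (strictMonoOn_expSeries hb hσ (sigmaCoeff_one α) 0 hy h2 h1).trans_le
      (expSeries_sigmaCoeff_le_one hα0 hα h2.le)⟩

theorem mul_expSeries_sigmaCoeff_one (hα0 : 0 < α) (hα : α ≤ 1) {y : ℝ}
    (hy : y < Real.log (gammaConst α)) :
    α * expSeries (sigmaCoeff α) 1 y = 1 - (1 - expSeries (sigmaCoeff α) 0 y) ^ α := by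
  have hb := sigmaCoeff_bound hα0 hα
  refine mul_eq_one_sub_rpow_of_eq_zero (fun z hz => hasDerivAt_expSeries hb 0 hz)
    (fun z hz => hasDerivAt_expSeries hb 1 hz) hα0
    (fun z hz => expSeries_sigmaCoeff_mem_Ioo hα0 hα hz)
    (tendsto_expSeries_atBot hb (sigmaCoeff_zero α) 0)
    (tendsto_expSeries_atBot hb (sigmaCoeff_zero α) 1) (fun z hz => ?_) hy
  refine (expSeries_ode_defect hb α hz).unique ?_
  simp [odeDefect_sigmaCoeff]

theorem logPotential_expSeries_sigmaCoeff (hα0 : 0 < α) (hα : α ≤ 1) {y : ℝ}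
    (hy : y < Real.log (gammaConst α)) :
    logPotential α ((1 - expSeries (sigmaCoeff α) 0 y) ^ α) = y - Real.log (gammaConst α) := by
  have hb := sigmaCoeff_bound hα0 hα
  exact logPotential_comp_eq hα0 hα (fun z hz => hasDerivAt_expSeries hb 0 hz)
    (fun z hz => expSeries_sigmaCoeff_mem_Ioo hα0 hα hz)
    (tendsto_expSeries_atBot hb (sigmaCoeff_zero α) 0)
    (sigmaCoeff_one α ▸ tendsto_exp_neg_mul_expSeries hb (sigmaCoeff_zero α) 0)
    (fun z hz => mul_expSeries_sigmaCoeff_one hα0 hα hz) hy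

/-- The terms are dominated by their values at the endpoint, where the series still converges, so
continuity reaches the closed half-line. -/
theorem continuousOn_expSeries_sigmaCoeff (hα0 : 0 < α) (hα : α ≤ 1) :
    ContinuousOn (expSeries (sigmaCoeff α) 0) (Iic (Real.log (gammaConst α))) := by
  refine continuousOn_tsum (fun k => by fun_prop) (summable_sigmaCoeff hα0 hα le_rfl)
    fun k y hy => ?_
  have h0 := sigmaCoeff_nonneg hα k
  rw [pow_zero, one_mul, Real.norm_of_nonneg (by positivity)]
  gcongr
  exact hy

/-- A value below 1 would give w > 0 at the endpoint with `logPotential` equal to 0 there by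
continuity, contradicting strict decrease from its value 0 at w = 0. -/
theorem expSeries_sigmaCoeff_log_gammaConst (hα0 : 0 < α) (hα : α ≤ 1) :
    expSeries (sigmaCoeff α) 0 (Real.log (gammaConst α)) = 1 := by
  set G := Real.log (gammaConst α)
  refine (expSeries_sigmaCoeff_le_one hα0 hα le_rfl).eq_or_lt.resolve_right fun hlt => ?_
  have hA : Tendsto (expSeries (sigmaCoeff α) 0) (𝓝[<] G) (𝓝 (expSeries (sigmaCoeff α) 0 G)) :=
    (continuousOn_expSeries_sigmaCoeff hα0 hα G self_mem_Iic).tendsto.mono_left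
      (nhdsWithin_mono _ Iio_subset_Iic_self)
  have hpos : 0 < expSeries (sigmaCoeff α) 0 G := by
    have := (summable_sigmaCoeff hα0 hα (le_refl G)).le_tsum 1
      (fun k _ => mul_nonneg (sigmaCoeff_nonneg hα k) (Real.exp_pos _).le)
    rw [(hasSum_sigmaCoeff hα0 hα (le_refl G)).tsum_eq, sigmaCoeff_one] at this
    exact lt_of_lt_of_le (by positivity) this
  have hw0 : 0 < (1 - expSeries (sigmaCoeff α) 0 G) ^ α := Real.rpow_pos_of_pos (by linarith) α
  have hw1 : (1 - expSeries (sigmaCoeff α) 0 G) ^ α < 1 :=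
    Real.rpow_lt_one (by linarith) (by linarith) hα0
  have hL := (hasDerivAt_logPotential hα0 hα ⟨hw0, hw1⟩).continuousAt.tendsto.comp
    ((hA.const_sub 1).rpow_const (p := α) (Or.inr hα0.le))
  have hR : Tendsto (fun x => x - G) (𝓝[<] G) (𝓝 (G - G)) :=
    (tendsto_id.mono_left nhdsWithin_le_nhds).sub_const _
  have heq := tendsto_nhds_unique_of_eventuallyEq hL hR (by
    filter_upwards [self_mem_nhdsWithin] with x hx
    exact logPotential_expSeries_sigmaCoeff hα0 hα hx)
  have := strictAntiOn_logPotential hα0 hα ⟨le_rfl, zero_lt_one⟩ ⟨hw0.le, hw1⟩ hw0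
  rw [logPotential_zero, heq, sub_self] at this
  exact lt_irrefl _ this

theorem isPowerODESolution_expSeries (hα0 : 0 < α) (hα : α ≤ 1) :
    IsPowerODESolution α
      fun x => 1 - expSeries (sigmaCoeff α) 0 (Real.log (gammaConst α) - α * x) := by
  have hb := sigmaCoeff_bound hα0 hα
  set G := Real.log (gammaConst α)
  set M : ℝ → ℝ := fun x => 1 - expSeries (sigmaCoeff α) 0 (G - α * x)
  have hM0 : M 0 = 0 := by simp [M, G, expSeries_sigmaCoeff_log_gammaConst hα0 hα]
  have hpos : ∀ x : ℝ, 0 < x → HasDerivAt M (1 - M x ^ α) x := by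
    intro x hx
    have hlt : G - α * x < G := by linarith [mul_pos hα0 hx]
    refine (((hasDerivAt_expSeries hb 0 hlt).comp x
      (((hasDerivAt_id x).const_mul α).const_sub G)).const_sub 1).congr_deriv ?_
    have := mul_expSeries_sigmaCoeff_one hα0 hα hlt
    simp only [M, zero_add]
    linear_combination this
  have hc : ContinuousOn M (Ici 0) := by
    refine continuousOn_const.sub ((continuousOn_expSeries_sigmaCoeff hα0 hα).comp
      (by fun_prop) fun x hx => ?_)
    have := mul_nonneg hα0.le (mem_Ici.1 hx)
    simp only [mem_Iic, G]
    linarith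
  refine ⟨hM0, fun x hx => ?_⟩
  rcases hx.eq_or_lt with rfl | hx
  -- Here x = 0 is the endpoint log γ_α, where termwise differentiation is not available; the
  -- one-sided derivative is the limit of 1 - M^α from the right.
  · refine hasDerivWithinAt_Ici_of_tendsto_deriv (s := Ioi 0)
      (fun x hx => (hpos x hx).differentiableAt.differentiableWithinAt)
      ((hc 0 self_mem_Ici).mono Ioi_subset_Ici_self) self_mem_nhdsWithin ?_
    have h := (((hc 0 self_mem_Ici).mono Ioi_subset_Ici_self).tendsto.rpow_const (p := α)
      (Or.inr hα0.le)).const_sub 1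
    refine h.congr' ?_
    filter_upwards [self_mem_nhdsWithin] with x hx
    exact (hpos x hx).deriv.symm
  · exact (hpos x hx).hasDerivWithinAt

end sigma

/-! ### Uniqueness for the differential equation. -/

section uniqueness

variable {α : ℝ} {F F₁ F₂ : ℝ → ℝ}

theorem IsPowerODESolution.continuousOn (h : IsPowerODESolution α F) : ContinuousOn F (Ici 0) :=
  fun x hx => (h.2 x hx).continuousWithinAt

theorem IsPowerODESolution.hasDerivAt (h : IsPowerODESolution α F) {x : ℝ} (hx : 0 < x) :
    HasDerivAt F (1 - F x ^ α) x :=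
  (h.2 x hx.le).hasDerivAt (Ici_mem_nhds hx)

/-- At the last time z with F z ≥ 0 before a negative value, F z = 0, so the derivative is 1; yet F
< 0 just afterwards makes the right slopes nonpositive. -/
theorem IsPowerODESolution.nonneg (hα0 : 0 < α) (h : IsPowerODESolution α F) {x : ℝ}
    (hx : 0 ≤ x) : 0 ≤ F x := by
  by_contra! hneg
  have hcont : ContinuousOn F (Icc 0 x) := h.continuousOn.mono Icc_subset_Ici_self
  have hcompact : IsCompact (Icc 0 x ∩ F ⁻¹' Ici 0) :=
    isCompact_Icc.of_isClosed_subset (hcont.preimage_isClosed_of_isClosed isClosed_Icc isClosed_Ici)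
      inter_subset_left
  obtain ⟨z, ⟨⟨hz0, hzx⟩, hFz⟩, hmax⟩ :=
    hcompact.exists_isGreatest ⟨0, ⟨le_rfl, hx⟩, h.1.ge⟩
  have hlt : z < x := hzx.lt_of_ne (by rintro rfl; exact absurd hFz (not_le.2 hneg))
  have hafter : ∀ y ∈ Ioc z x, F y < 0 := by
    intro y hy
    by_contra! hy0
    exact absurd (hmax ⟨⟨hz0.trans hy.1.le, hy.2⟩, hy0⟩) (not_le.2 hy.1)
  have hIoc : Ioc z x ∈ 𝓝[>] z := Ioc_mem_nhdsGT hlt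
  have hd : HasDerivWithinAt F (1 - F z ^ α) (Ioi z) z :=
    (h.2 z hz0).mono fun y hy => hz0.trans (le_of_lt hy)
  have hFz0 : F z = 0 := by
    refine le_antisymm (le_of_tendsto hd.continuousWithinAt.tendsto ?_) hFz
    filter_upwards [hIoc] with y hy using (hafter y hy).le
  rw [hFz0, Real.zero_rpow hα0.ne', sub_zero] at hd
  have hs := hasDerivWithinAt_iff_tendsto_slope' (by simp) |>.1 hd
  have : (1 : ℝ) ≤ 0 := by
    refine le_of_tendsto hs ?_
    filter_upwards [hIoc] with y hy
    rw [slope_def_field, hFz0, sub_zero]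
    exact div_nonpos_of_nonpos_of_nonneg (hafter y hy).le (by linarith [hy.1])
  linarith

/-- The squared difference starts at 0 and cannot grow, since u ↦ u^α is monotone on the nonnegative
values taken. No Lipschitz condition is needed at 0. -/
theorem IsPowerODESolution.eq (hα0 : 0 < α) (h₁ : IsPowerODESolution α F₁)
    (h₂ : IsPowerODESolution α F₂) {x : ℝ} (hx : 0 ≤ x) : F₁ x = F₂ x := by
  have hanti : AntitoneOn (fun y => (F₁ y - F₂ y) ^ 2) (Ici 0) := by
    have hd : ∀ y : ℝ, 0 < y → HasDerivAt (fun y => (F₁ y - F₂ y) ^ 2)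
        (2 * (F₁ y - F₂ y) * (F₂ y ^ α - F₁ y ^ α)) y := fun y hy =>
      (((h₁.hasDerivAt hy).sub (h₂.hasDerivAt hy)).pow 2).congr_deriv (by simp)
    refine antitoneOn_of_deriv_nonpos (convex_Ici 0)
      ((h₁.continuousOn.sub h₂.continuousOn).pow 2) ?_ ?_ <;> rw [interior_Ici]
    · exact fun y hy => (hd y hy).differentiableAt.differentiableWithinAt
    · intro y hy
      rw [(hd y hy).deriv]
      have hy' : (0 : ℝ) ≤ y := le_of_lt hy
      rcases le_total (F₁ y) (F₂ y) with hle | hle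
      · have := Real.rpow_le_rpow (h₁.nonneg hα0 hy') hle hα0.le
        exact mul_nonpos_of_nonpos_of_nonneg (by linarith) (by linarith)
      · have := Real.rpow_le_rpow (h₂.nonneg hα0 hy') hle hα0.le
        exact mul_nonpos_of_nonneg_of_nonpos (by linarith) (by linarith)
  have h := hanti self_mem_Ici hx hx
  simp only [h₁.1, h₂.1, sub_self, ne_eq, OfNat.ofNat_ne_zero, not_false_eq_true, zero_pow] at h
  exact sub_eq_zero.1 (pow_eq_zero_iff two_ne_zero |>.1 (le_antisymm h (sq_nonneg _)))

end uniqueness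

/-! ### Uniqueness of the Laplace measure. -/

section laplace

/-- The polynomials in `e^{-t}`, as bounded continuous functions on `[0, ∞)`. -/
noncomputable def expPolynomials : StarSubalgebra ℝ (BoundedContinuousFunction ℝ≥0 ℝ) where
  carrier := {g | ∃ p : Polynomial ℝ, ∀ t : ℝ≥0, g t = p.eval (Real.exp (-t))}
  mul_mem' := by
    rintro a b ⟨p, hp⟩ ⟨q, hq⟩
    exact ⟨p * q, fun t => by simp [hp, hq]⟩
  add_mem' := by
    rintro a b ⟨p, hp⟩ ⟨q, hq⟩
    exact ⟨p + q, fun t => by simp [hp, hq]⟩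
  algebraMap_mem' r := ⟨Polynomial.C r, fun t => by simp⟩
  star_mem' := by
    rintro a ⟨p, hp⟩
    exact ⟨p, fun t => by simp [hp]⟩

theorem separatesPoints_expPolynomials :
    (expPolynomials.map (BoundedContinuousFunction.toContinuousMapStarₐ ℝ)).SeparatesPoints := by
  intro s t hst
  let e : BoundedContinuousFunction ℝ≥0 ℝ := BoundedContinuousFunction.ofNormedAddCommGroup
    (fun t : ℝ≥0 => Real.exp (-t)) (by fun_prop) 1 (fun t => by simp)
  have he : e ∈ expPolynomials := ⟨Polynomial.X, fun t => by simp [e]⟩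
  refine ⟨e, ⟨e.toContinuousMap, ⟨e, he, rfl⟩, rfl⟩, fun h => hst ?_⟩
  have h' : Real.exp (-(s : ℝ)) = Real.exp (-(t : ℝ)) := h
  exact NNReal.coe_injective (neg_injective (Real.exp_injective h'))

variable {μ ν : Measure ℝ} {f : ℝ → ℝ}

theorem IsLaplaceMeasure.isFiniteMeasure (h : IsLaplaceMeasure μ f) : IsFiniteMeasure μ := by
  have := (h.2 0 le_rfl).1
  simpa [integrable_const_iff] using this

theorem IsLaplaceMeasure.ae_nonneg (h : IsLaplaceMeasure μ f) : ∀ᵐ t ∂μ, 0 ≤ t := by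
  rw [ae_iff]
  simpa [Iio] using h.1

theorem IsLaplaceMeasure.integral_polynomial (h : IsLaplaceMeasure μ f) (p : Polynomial ℝ) :
    ∫ t, p.eval (Real.exp (-(Real.toNNReal t : ℝ))) ∂μ = p.sum fun k a => a * f k := by
  have h1 : ∫ t, p.eval (Real.exp (-(Real.toNNReal t : ℝ))) ∂μ =
      ∫ t, ∑ k ∈ p.support, p.coeff k * Real.exp (-(k * t)) ∂μ := by
    refine integral_congr_ae ?_
    filter_upwards [h.ae_nonneg] with t ht
    rw [Real.coe_toNNReal t ht, Polynomial.eval_eq_sum, Polynomial.sum]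
    refine Finset.sum_congr rfl fun k _ => ?_
    rw [← Real.exp_nat_mul, mul_neg]
  rw [h1, integral_finsetSum _ fun (k : ℕ) _ => (h.2 k k.cast_nonneg).1.const_mul _, Polynomial.sum]
  refine Finset.sum_congr rfl fun k _ => ?_
  rw [integral_const_mul, ← (h.2 k k.cast_nonneg).2]

/-- Moving to `ℝ≥0` loses nothing, and there e^{-t} is a bounded function. -/
theorem IsLaplaceMeasure.map_coe_map_toNNReal (h : IsLaplaceMeasure μ f) :
    (μ.map Real.toNNReal).map ((↑) : ℝ≥0 → ℝ) = μ := by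
  rw [Measure.map_map (by fun_prop) (by fun_prop)]
  conv_rhs => rw [← Measure.map_id (μ := μ)]
  refine Measure.map_congr ?_
  filter_upwards [h.ae_nonneg] with t ht
  exact Real.coe_toNNReal t ht

theorem IsLaplaceMeasure.unique (hμ : IsLaplaceMeasure μ f) (hν : IsLaplaceMeasure ν f) :
    μ = ν := by
  have := hμ.isFiniteMeasure
  have := hν.isFiniteMeasure
  rw [← hμ.map_coe_map_toNNReal, ← hν.map_coe_map_toNNReal]
  congr 1
  refine ext_of_forall_mem_subalgebra_integral_eq_of_pseudoEMetric_complete_countable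
    separatesPoints_expPolynomials ?_
  rintro g ⟨p, hp⟩
  rw [integral_map (by fun_prop) (by fun_prop), integral_map (by fun_prop) (by fun_prop)]
  simp_rw [hp]
  rw [hμ.integral_polynomial, hν.integral_polynomial]

end laplace

/-! ### The atomic measure and the profile. -/

section expCoeff

variable {n : ℕ}

theorem two_div_natCast_mem_Ioc (hn : 2 ≤ n) : 2 / (n : ℝ) ∈ Ioc (0 : ℝ) 1 := by
  have h : (2 : ℝ) ≤ n := by exact_mod_cast hn
  exact ⟨by positivity, div_le_one_of_le₀ h (by positivity)⟩

theorem expCoeff_nonneg (hn : 2 ≤ n) (k : ℕ) : 0 ≤ expCoeff n k :=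
  have h := two_div_natCast_mem_Ioc hn
  mul_nonneg (sigmaCoeff_nonneg h.2 k) (pow_nonneg (gammaConst_pos h.1).le k)

theorem gammaConst_one : gammaConst 1 = 1 := by
  simp [gammaConst]

theorem exists_isProfile (hn : 2 ≤ n) : ∃ M, IsProfile n M :=
  ⟨_, isPowerODESolution_expSeries (two_div_natCast_mem_Ioc hn).1 (two_div_natCast_mem_Ioc hn).2⟩

theorem IsProfile.hasSum (hn : 2 ≤ n) {M : ℝ → ℝ} (hM : IsProfile n M) {x : ℝ} (hx : 0 ≤ x) :
    HasSum (fun j : ℕ => expCoeff n (j + 1) * Real.exp (-2 * ((j : ℝ) + 1) * x / (n : ℝ)))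
      (1 - M x) := by
  obtain ⟨hα0, hα⟩ := two_div_natCast_mem_Ioc hn
  rw [hM.eq hα0 (isPowerODESolution_expSeries hα0 hα) hx, sub_sub_cancel]
  have h := hasSum_sigmaCoeff hα0 hα (y := Real.log (gammaConst (2 / (n : ℝ))) - 2 / (n : ℝ) * x)
    (sub_le_self _ (by positivity))
  -- The sum is reindexed to start at k = 1; the dropped term is σ_0 = 0.
  rw [← hasSum_nat_add_iff' 1] at h
  simp only [Finset.range_one, Finset.sum_singleton, sigmaCoeff_zero, zero_mul, sub_zero] at h
  refine h.congr_fun fun j => ?_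
  rw [expCoeff, ← exp_mul_log_gammaConst hα0, mul_assoc, ← Real.exp_add]
  congr 2
  push_cast
  ring

theorem isLaplaceMeasure_atomicMeasure (hn : 2 ≤ n) {M : ℝ → ℝ} (hM : IsProfile n M) :
    IsLaplaceMeasure (atomicMeasure n) fun x => 1 - M x := by
  refine ⟨?_, fun x hx => ?_⟩
  · rw [atomicMeasure, Measure.sum_apply _ measurableSet_Iio, ENNReal.tsum_eq_zero]
    intro j
    have : (0 : ℝ) ≤ 2 * ((j : ℝ) + 1) / n := by positivity
    simp [this]
  · have h := hM.hasSum hn hx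
    have hterm : ∀ j : ℕ, (ENNReal.ofReal (expCoeff n (j + 1))).toReal *
        Real.exp (-(x * (2 * ((j : ℝ) + 1) / n))) =
        expCoeff n (j + 1) * Real.exp (-2 * ((j : ℝ) + 1) * x / (n : ℝ)) := by
      intro j
      rw [ENNReal.toReal_ofReal (expCoeff_nonneg hn _)]
      congr 2
      ring
    have hs : Summable fun j : ℕ => (ENNReal.ofReal (expCoeff n (j + 1))).toReal *
        ‖Real.exp (-(x * (2 * ((j : ℝ) + 1) / n)))‖ := by
      simp_rw [Real.norm_eq_abs, Real.abs_exp, hterm]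
      exact h.summable
    refine ⟨integrable_sum_dirac (fun _ => ENNReal.ofReal_ne_top) hs, ?_⟩
    have hi := hasSum_integral_sum_dirac (f := fun t : ℝ => Real.exp (-(x * t)))
      (x := fun j : ℕ => 2 * ((j : ℝ) + 1) / n) (fun _ => ENNReal.ofReal_ne_top) hs
    simp_rw [smul_eq_mul, hterm] at hi
    exact h.unique hi

theorem atomicMeasure_singleton (hn : 2 ≤ n) {k : ℕ} (hk : 1 ≤ k) :
    atomicMeasure n {2 / (n : ℝ) * (k : ℝ)} = ENNReal.ofReal (expCoeff n k) := by
  have hn0 : (n : ℝ) ≠ 0 := by positivity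
  rw [atomicMeasure, Measure.sum_apply _ (measurableSet_singleton _), tsum_eq_single (k - 1)]
  · have : 2 * (((k - 1 : ℕ) : ℝ) + 1) / n = 2 / (n : ℝ) * (k : ℝ) := by
      push_cast [Nat.cast_sub hk]
      ring
    rw [this, Nat.sub_add_cancel hk]
    simp
  · intro j hj
    have : 2 * ((j : ℝ) + 1) / n ≠ 2 / (n : ℝ) * (k : ℝ) := by
      intro h
      field_simp at h
      have : j + 1 = k := by exact_mod_cast h
      omega
    simp [this]

theorem atomicMeasure_compl (n : ℕ) :
    atomicMeasure n {t : ℝ | ∃ k : ℕ, 1 ≤ k ∧ t = 2 / (n : ℝ) * (k : ℝ)}ᶜ = 0 := by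
  have hc : {t : ℝ | ∃ k : ℕ, 1 ≤ k ∧ t = 2 / (n : ℝ) * (k : ℝ)}.Countable :=
    (countable_range fun k : ℕ => 2 / (n : ℝ) * (k : ℝ)).mono
      (by rintro _ ⟨k, -, rfl⟩; exact ⟨k, rfl⟩)
  rw [atomicMeasure, Measure.sum_apply _ hc.measurableSet.compl, ENNReal.tsum_eq_zero]
  intro j
  have : ∃ k : ℕ, 1 ≤ k ∧ 2 * ((j : ℝ) + 1) / n = 2 / (n : ℝ) * (k : ℝ) :=
    ⟨j + 1, by omega, by push_cast; ring⟩
  rw [Measure.smul_apply, Measure.dirac_apply' _ hc.measurableSet.compl,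
    indicator_of_notMem (by simpa using this), smul_zero]

/-- The total mass is the sum of the coefficients, which is 1 - M 0 = 1 by the expansion at x = 0.
-/
theorem isProbabilityMeasure_atomicMeasure (hn : 2 ≤ n) :
    IsProbabilityMeasure (atomicMeasure n) := by
  obtain ⟨M, hM⟩ := exists_isProfile hn
  have h := hM.hasSum hn le_rfl
  rw [show M 0 = 0 from hM.1, sub_zero] at h
  simp only [mul_zero, zero_div, Real.exp_zero, mul_one] at h
  refine ⟨?_⟩
  rw [atomicMeasure, Measure.sum_apply _ MeasurableSet.univ]
  simp only [Measure.smul_apply, measure_univ, smul_eq_mul, mul_one]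
  rw [← ENNReal.ofReal_tsum_of_nonneg (fun j => expCoeff_nonneg hn _) h.summable, h.tsum_eq,
    ENNReal.ofReal_one]

end expCoeff

theorem mainTheorem8 (n : ℕ) (hn : 2 ≤ n) :
    (∃ M : ℝ → ℝ, IsProfile n M) ∧
    (3 ≤ n → ∀ k : ℕ, 1 ≤ k → 0 < expCoeff n k) ∧
    (n = 2 → expCoeff n 1 = 1 ∧ ∀ k : ℕ, 2 ≤ k → expCoeff n k = 0) ∧
    ∀ M : ℝ → ℝ, IsProfile n M →
      (∀ x : ℝ, 0 ≤ x →
        HasSum (fun j : ℕ => expCoeff n (j + 1) * Real.exp (-2 * ((j : ℝ) + 1) * x / (n : ℝ)))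
          (1 - M x)) ∧
      (∃ μ : Measure ℝ, IsProbabilityMeasure μ ∧ IsLaplaceMeasure μ (fun x => 1 - M x)) ∧
      (∀ μ : Measure ℝ, IsLaplaceMeasure μ (fun x => 1 - M x) →
        μ = atomicMeasure n ∧
        μ {t : ℝ | ∃ k : ℕ, 1 ≤ k ∧ t = 2 / (n : ℝ) * (k : ℝ)}ᶜ = 0 ∧
        ∀ k : ℕ, 1 ≤ k → μ {2 / (n : ℝ) * (k : ℝ)} = ENNReal.ofReal (expCoeff n k)) := by
  refine ⟨exists_isProfile hn, fun h3 k hk => ?_, ?_, fun M hM =>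
    ⟨fun x hx => hM.hasSum hn hx,
      ⟨atomicMeasure n, isProbabilityMeasure_atomicMeasure hn, isLaplaceMeasure_atomicMeasure hn hM⟩,
      fun μ hμ => ?_⟩⟩
  · have h3' : (3 : ℝ) ≤ n := by exact_mod_cast h3
    exact mul_pos (sigmaCoeff_pos ((div_lt_one (by linarith)).2 (by linarith)) k hk)
      (pow_pos (gammaConst_pos (two_div_natCast_mem_Ioc hn).1) k)
  · rintro rfl
    have h1 : (2 : ℝ) / ((2 : ℕ) : ℝ) = 1 := by norm_num
    refine ⟨?_, fun k hk => ?_⟩ <;> rw [expCoeff, h1]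
    · simp [sigmaCoeff_one, gammaConst_one]
    · simp [sigmaCoeff_one_eq_zero k hk]
  · obtain rfl := hμ.unique (isLaplaceMeasure_atomicMeasure hn hM)
    exact ⟨rfl, atomicMeasure_compl n, fun k hk => atomicMeasure_singleton hn hk⟩
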